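/- Let $r\ge 1$ and let $c_1,\dots,c_r$ be pairwise distinct real numbers. For every multi-index $\vec n=(n_1,\dots,n_r)\in\{0,1,2,\dots\}^r$ there is exactly one monic real polynomial $H_{\vec n}$ of degree $|\vec n|=n_1+\cdots+n_r$ such that $$\int_{-\infty}^{\infty}x^kH_{\vec n}(x)e^{-x^2+c_jx}\,dx=0,\qquad k=0,1,\dots,n_j-1,\quad j=1,\dots,r$$ (the multiple Hermite polynomial). Let $\vec e_j$ be the $j$-th standard unit vector. For a multi-index $\vec n$, $j\in\{1,\dots,r\}$, an integer $l\ge1$ and $x\in\mathbb R$ put $$T\big(H_{\vec n}(x),H_{\vec n+\vec e_j}(x),\dots,H_{\vec n+(l-1)\vec e_j}(x)\big)=\det\big(H_{\vec n+(i+k)\vec e_j}(x)\big)_{i,k=0}^{l-1},$$ $$W\big(H_{\vec n}(x),H_{\vec n+\vec e_j}(x),\dots,H_{\vec n+(l-1)\vec e_j}(x)\big)=\det\big(H^{(i)}_{\vec n+k\vec e_j}(x)\big)_{i,k=0}^{l-1},$$ where $H^{(i)}$ is the $i$-th derivative. Then for all such $\vec n,j,l$ and all $x\in\mathbb R$ $$W\big(H_{\vec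 n}(x),\dots,H_{\vec n+(l-1)\vec e_j}(x)\big)=(-2)^{l(l-1)/2}\,T\big(H_{\vec n}(x),\dots,H_{\vec n+(l-1)\vec e_j}(x)\big),$$ and, if $l$ is even, $$(-1)^{l(l-1)/2}\,T\big(H_{\vec n}(x),H_{\vec n+\vec e_j}(x),\dots,H_{\vec n+(l-1)\vec e_j}(x)\big)>0 .$$ -/

import Mathlib

/-- `P` is the (type II) multiple Hermite polynomial with parameters `c₁, …, c_r` and
multi-index `n`: monic of degree `|n| = n₁ + ⋯ + n_r` and orthogonal to `1, x, …, x ^ (n_j - 1)`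
with respect to the weight `exp (-x² + c_j x)` on the real line, for every `j`. -/
structure IsMultipleHermite {r : ℕ} (c : Fin r → ℝ) (n : Fin r → ℕ) (P : Polynomial ℝ) : Prop where
  monic : P.Monic
  natDegree_eq : P.natDegree = ∑ j, n j
  orthogonal : ∀ j : Fin r, ∀ k : ℕ, k < n j →
    ∫ x : ℝ, x ^ k * P.eval x * Real.exp (-x ^ 2 + c j * x) = 0

/-- The Wronskian `W(f₀, …, f_{l-1})` at `x` of the first `l` members of a sequence of
polynomials: row `i` holds the `i`-th derivatives. -/
noncomputable def wronskianDet (l : ℕ) (f : ℕ → Polynomial ℝ) (x : ℝ) : ℝ :=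
  (Matrix.of fun i k : Fin l => (Polynomial.derivative^[(i : ℕ)] (f k)).eval x).det

/-- The `l × l` Hankel determinant (Turánian) `T(f₀, …, f_{l-1})` at `x`, with entries
`f_{i+k}(x)` for `0 ≤ i, k ≤ l - 1`. -/
noncomputable def hankelDet (l : ℕ) (f : ℕ → Polynomial ℝ) (x : ℝ) : ℝ :=
  (Matrix.of fun i k : Fin l => (f ((i : ℕ) + (k : ℕ))).eval x).det

/-! Integration by parts against `exp (-x² + c_j x)`, together with uniqueness, gives the raising
relation `H_{n+e_j} = (x - c_j/2) H_n - H_n'/2`. Hence, along the direction `e_j`, differentiation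
is a combination of staying put and shifting the index. The Wronskian matrix is therefore a lower
triangular matrix with diagonal `(-2)^i` times the Hankel matrix (`wronskianDet_eq_hankelDet`).

For positivity with `l` even, suppose the Wronskian vanishes at `x`. Some nontrivial combination `P`
of the `l` polynomials then has a zero of order at least `l` at `x`. By linearity `P` arises from a
nonzero polynomial by `|n|` raisings, each adding a sign change by Rolle's theorem
(`alternates_sum_smul`). Dividing out the even zero keeps these sign changes, so `|n| + l ≤ deg P ≤
|n| + l - 1`, which is absurd. So the Wronskian has constant sign, read off at `+∞` from a
Vandermonde determinant (`eventually_wronskianDet_pos`). -/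

open Polynomial MeasureTheory Filter Topology

/-! ### Raising operator and Gaussian moments -/

/-- The raising operator `P ↦ (X - a / 2) P - P' / 2`, i.e. `-1/2` times the derivative
conjugated by the weight `exp (-x² + a x)`. -/
noncomputable def raise (a : ℝ) : ℝ[X] →ₗ[ℝ] ℝ[X] :=
  LinearMap.mulLeft ℝ (X - C (a / 2)) - (1 / 2 : ℝ) • derivative

theorem raise_apply (a : ℝ) (P : ℝ[X]) :
    raise a P = (X - C (a / 2)) * P - C (1 / 2) * derivative P := by
  simp [raise, smul_eq_C_mul]

theorem integrable_eval_mul_weight (a : ℝ) (P : ℝ[X]) :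
    Integrable fun x : ℝ => P.eval x * Real.exp (-x ^ 2 + a * x) := by
  have centered : ∀ Q : ℝ[X], Integrable fun x : ℝ => Q.eval x * Real.exp (-x ^ 2) := by
    intro Q
    induction Q using Polynomial.induction_on' with
    | add p q hp hq =>
      simp only [eval_add, add_mul]
      exact hp.add hq
    | monomial k b =>
      have h := integrable_rpow_mul_exp_neg_mul_sq (b := 1) one_pos (s := (k : ℝ))
        (by linarith [(Nat.cast_nonneg k : (0 : ℝ) ≤ k)])
      simpa [Real.rpow_natCast, mul_assoc] using h.const_mul b
  -- Completing the square: `-x² + a x = -(x - a/2)² + a²/4`.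
  have h := ((centered (P.comp (X + C (a / 2)))).comp_sub_right (a / 2)).mul_const
    (Real.exp (a ^ 2 / 4))
  refine h.congr (Eventually.of_forall fun x => ?_)
  simp only [eval_comp, eval_add, eval_X, eval_C, sub_add_cancel, mul_assoc, ← Real.exp_add]
  ring_nf

/-- Integration of polynomials against the weight `exp (-x² + a x)`. -/
noncomputable def moment (a : ℝ) : ℝ[X] →ₗ[ℝ] ℝ where
  toFun P := ∫ x : ℝ, P.eval x * Real.exp (-x ^ 2 + a * x)
  map_add' P Q := by
    simp only [eval_add, add_mul]
    exact integral_add (integrable_eval_mul_weight a P) (integrable_eval_mul_weight a Q)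
  map_smul' b P := by
    simp only [eval_smul, smul_eq_mul, mul_assoc, RingHom.id_apply]
    exact integral_const_mul _ _

theorem moment_apply (a : ℝ) (P : ℝ[X]) :
    moment a P = ∫ x : ℝ, P.eval x * Real.exp (-x ^ 2 + a * x) := rfl

theorem moment_one_pos (a : ℝ) : 0 < moment a 1 := by
  have hint := integrable_eval_mul_weight a 1
  rw [moment_apply]
  simp only [eval_one, one_mul] at hint ⊢
  exact integral_exp_pos hint

theorem hasDerivAt_eval_mul_weight (a : ℝ) (P : ℝ[X]) (x : ℝ) :
    HasDerivAt (fun x : ℝ => P.eval x * Real.exp (-x ^ 2 + a * x))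
      (((-2 : ℝ) • raise a P).eval x * Real.exp (-x ^ 2 + a * x)) x := by
  have h1 : HasDerivAt (fun x : ℝ => -x ^ 2 + a * x) (-(2 * x) + a) x := by
    refine ((hasDerivAt_pow 2 x).neg.add ((hasDerivAt_id x).const_mul a)).congr_deriv ?_
    simp
  refine ((P.hasDerivAt x).mul h1.exp).congr_deriv ?_
  simp only [raise_apply, eval_smul, eval_sub, eval_mul, eval_X, eval_C, smul_eq_mul]
  ring

theorem moment_raise (a : ℝ) (P : ℝ[X]) : moment a (raise a P) = 0 := by
  have h : moment a ((-2 : ℝ) • raise a P) = 0 :=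
    integral_eq_zero_of_hasDerivAt_of_integrable (hasDerivAt_eval_mul_weight a P)
      (integrable_eval_mul_weight a _) (integrable_eval_mul_weight a P)
  simpa using h

theorem tendsto_eval_mul_weight_atTop (a : ℝ) (P : ℝ[X]) :
    Tendsto (fun x : ℝ => P.eval x * Real.exp (-x ^ 2 + a * x)) atTop (𝓝 0) :=
  tendsto_zero_of_hasDerivAt_of_integrableOn_Ioi (a := 0)
    (fun x _ => hasDerivAt_eval_mul_weight a P x)
    (integrable_eval_mul_weight a _).integrableOn (integrable_eval_mul_weight a P).integrableOn

theorem tendsto_eval_mul_weight_atBot (a : ℝ) (P : ℝ[X]) :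
    Tendsto (fun x : ℝ => P.eval x * Real.exp (-x ^ 2 + a * x)) atBot (𝓝 0) :=
  tendsto_zero_of_hasDerivAt_of_integrableOn_Iic (a := 0)
    (fun x _ => hasDerivAt_eval_mul_weight a P x)
    (integrable_eval_mul_weight a _).integrableOn (integrable_eval_mul_weight a P).integrableOn

/-- At `k = 0` the truncated exponent is harmless, its coefficient being zero. -/
theorem moment_X_pow_mul_raise (a b : ℝ) (k : ℕ) (P : ℝ[X]) :
    moment b (X ^ k * raise a P) =
      (k : ℝ) / 2 * moment b (X ^ (k - 1) * P) + (b - a) / 2 * moment b (X ^ k * P) := by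
  have key : X ^ k * raise a P = raise b (X ^ k * P) + ((k : ℝ) / 2) • (X ^ (k - 1) * P) +
      ((b - a) / 2) • (X ^ k * P) := by
    have hb : (C ((b - a) / 2) : ℝ[X]) = C (b / 2) - C (a / 2) := by
      rw [← C_sub]; congr 1; ring
    have hk : (C ((k : ℝ) / 2) : ℝ[X]) = C (1 / 2) * C (k : ℝ) := by
      rw [← C_mul]; congr 1; ring
    simp only [raise_apply, smul_eq_C_mul, derivative_mul, derivative_X_pow, hb, hk]
    ring
  rw [key, map_add, map_add, moment_raise, map_smul, map_smul, zero_add, smul_eq_mul, smul_eq_mul]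

/-! ### Orthogonality, existence and uniqueness -/

/-- Orthogonality to `1, x, …, x ^ (n_j - 1)` for each of the weights `exp (-x² + c_j x)`. -/
def IsOrthogonal {r : ℕ} (c : Fin r → ℝ) (n : Fin r → ℕ) (P : ℝ[X]) : Prop :=
  ∀ j : Fin r, ∀ k : ℕ, k < n j → moment (c j) (X ^ k * P) = 0

theorem IsMultipleHermite.isOrthogonal {r : ℕ} {c : Fin r → ℝ} {n : Fin r → ℕ} {P : ℝ[X]}
    (h : IsMultipleHermite c n P) : IsOrthogonal c n P := by
  intro j k hk
  simpa [moment_apply] using h.orthogonal j k hk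

theorem IsOrthogonal.raise {r : ℕ} {c : Fin r → ℝ} {n : Fin r → ℕ} {P : ℝ[X]}
    (h : IsOrthogonal c n P) (j : Fin r) :
    IsOrthogonal c (n + Pi.single j 1) (raise (c j) P) := by
  intro i k hk
  rw [moment_X_pow_mul_raise]
  by_cases hij : i = j
  · subst hij
    rcases k with _ | k
    · simp
    · simp only [Pi.add_apply, Pi.single_eq_same] at hk
      simp [h i k (by omega)]
  · simp only [Pi.add_apply, Pi.single_eq_of_ne hij, add_zero] at hk
    rw [h i k hk, h i (k - 1) (by omega)]
    simp

/-- In `moment_X_pow_mul_raise` the moments of `P` carry nonzero factors: `(k + 1) / 2` for the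
weight `j` itself, and `(c i - c j) / 2` for the others. Distinctness of the parameters enters here.
-/
theorem IsOrthogonal.of_raise {r : ℕ} {c : Fin r → ℝ} (hc : Function.Injective c)
    {n : Fin r → ℕ} {P : ℝ[X]} {j : Fin r}
    (h : IsOrthogonal c (n + Pi.single j 1) (_root_.raise (c j) P)) : IsOrthogonal c n P := by
  intro i k hk
  by_cases hij : i = j
  · subst hij
    have := h i (k + 1) (by simpa using hk)
    rw [moment_X_pow_mul_raise] at this
    have hk0 : ((k : ℝ) + 1) / 2 ≠ 0 := by positivity
    simpa [hk0] using this
  · induction k with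
    | zero =>
      have := h i 0 (by simpa [hij] using hk)
      rw [moment_X_pow_mul_raise] at this
      simpa [sub_eq_zero, hc.eq_iff, hij] using this
    | succ k ih =>
      have := h i (k + 1) (by simpa [hij] using hk)
      rw [moment_X_pow_mul_raise] at this
      simpa [ih (by omega), sub_eq_zero, hc.eq_iff, hij] using this

theorem monic_raise {a : ℝ} {P : ℝ[X]} (hP : P.Monic) :
    (raise a P).Monic ∧ (raise a P).natDegree = P.natDegree + 1 := by
  have hm : ((X - C (a / 2)) * P).Monic := (monic_X_sub_C _).mul hP
  have hd : ((X - C (a / 2)) * P).natDegree = P.natDegree + 1 := by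
    rw [(monic_X_sub_C _).natDegree_mul hP, natDegree_X_sub_C, add_comm]
  have hlt : (C (1 / 2) * derivative P).degree < ((X - C (a / 2)) * P).degree := by
    rw [degree_eq_natDegree hm.ne_zero, hd]
    rw [degree_C_mul (by norm_num)]
    refine degree_derivative_le.trans_lt ?_
    rw [degree_eq_natDegree hP.ne_zero]
    exact_mod_cast Nat.lt_succ_self _
  rw [raise_apply]
  refine ⟨hm.sub_of_left hlt, ?_⟩
  rw [natDegree_sub_eq_left_of_natDegree_lt ?_, hd]
  have := natDegree_C_mul_le (1 / 2 : ℝ) (derivative P)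
  have := natDegree_derivative_le P
  omega

theorem sum_add_single {r : ℕ} (n : Fin r → ℕ) (j : Fin r) (m : ℕ) :
    ∑ i, (n + m • Pi.single j 1 : Fin r → ℕ) i = ∑ i, n i + m := by
  simp [Finset.sum_add_distrib, ← Finset.mul_sum]

theorem multiIndex_induction {r : ℕ} {p : (Fin r → ℕ) → Prop} (zero : p 0)
    (add_single : ∀ n j, p n → p (n + Pi.single j 1)) (n : Fin r → ℕ) : p n := by
  induction hN : ∑ i, n i generalizing n with
  | zero =>
    have : n = 0 := by
      ext i
      exact (Finset.sum_eq_zero_iff.1 hN) i (Finset.mem_univ i)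
    rwa [this]
  | succ N ih =>
    obtain ⟨j, -, hj⟩ : ∃ j ∈ Finset.univ, n j ≠ 0 :=
      Finset.exists_ne_zero_of_sum_ne_zero (by omega)
    have hn : n = (n - Pi.single j 1) + Pi.single j 1 := by
      ext i
      by_cases hij : i = j
      · subst hij; simp; omega
      · simp [hij]
    rw [hn]
    refine add_single _ _ (ih _ ?_)
    have := sum_add_single (n - Pi.single j 1) j 1
    rw [one_smul, ← hn] at this
    omega

theorem IsMultipleHermite.raise {r : ℕ} {c : Fin r → ℝ} {n : Fin r → ℕ} {P : ℝ[X]}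
    (h : IsMultipleHermite c n P) (j : Fin r) :
    IsMultipleHermite c (n + Pi.single j 1) (raise (c j) P) where
  monic := (monic_raise h.monic).1
  natDegree_eq := by
    have := sum_add_single n j 1
    rw [one_smul] at this
    rw [(monic_raise h.monic).2, h.natDegree_eq, this]
  orthogonal i k hk := by
    simpa [moment_apply] using h.isOrthogonal.raise j i k hk

theorem exists_isMultipleHermite {r : ℕ} (c : Fin r → ℝ) (n : Fin r → ℕ) :
    ∃ P : ℝ[X], IsMultipleHermite c n P := by
  induction n using multiIndex_induction with
  | zero => exact ⟨1, monic_one, by simp, by simp⟩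
  | add_single n j ih =>
    obtain ⟨P, hP⟩ := ih
    exact ⟨_, hP.raise j⟩

/-- The polynomials `raise a (X ^ m)` are monic of degree `m + 1`, so together with the constants
they form a triangular basis. -/
theorem exists_eq_raise_add_C (a : ℝ) (N : ℕ) (R : ℝ[X]) (hR : R.degree < (N + 1 : ℕ)) :
    ∃ (Q : ℝ[X]) (b : ℝ), Q.degree < N ∧ R = raise a Q + C b := by
  induction N generalizing R with
  | zero =>
    refine ⟨0, R.coeff 0, by simp, ?_⟩
    rw [map_zero, zero_add]
    refine eq_C_of_natDegree_le_zero (Nat.lt_succ_iff.1 ?_)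
    by_cases h0 : R = 0
    · simp [h0]
    · exact (natDegree_lt_iff_degree_lt h0).2 hR
  | succ N ih =>
    obtain ⟨hm, hd⟩ := monic_raise (a := a) (monic_X_pow (R := ℝ) N)
    rw [natDegree_X_pow] at hd
    obtain ⟨Q, b, hQ, h⟩ := ih (R - R.coeff (N + 1) • raise a (X ^ N)) (by
      rw [degree_lt_iff_coeff_zero] at hR ⊢
      intro m hmN
      rcases hmN.eq_or_lt with rfl | hlt
      · have : (raise a (X ^ N)).coeff (N + 1) = 1 := by rw [← hd]; exact hm
        simp [this]
      · have : (raise a (X ^ N)).coeff m = 0 := coeff_eq_zero_of_natDegree_lt (by omega)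
        simp [this, hR m (by omega)])
    refine ⟨Q + R.coeff (N + 1) • X ^ N, b, ?_, ?_⟩
    · rw [degree_lt_iff_coeff_zero] at hQ ⊢
      intro m hmN
      have : m ≠ N := by omega
      simp [hQ m (by omega), coeff_X_pow, this]
    · rw [map_add, map_smul, add_right_comm, ← h]
      simp

/-- In `R = raise (c j) Q + b`, the zeroth moment for `c j` forces `b = 0`; orthogonality then
descends to `Q`, of smaller degree. -/
theorem IsOrthogonal.eq_zero {r : ℕ} {c : Fin r → ℝ} (hc : Function.Injective c)
    {n : Fin r → ℕ} {R : ℝ[X]} (h : IsOrthogonal c n R)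
    (hR : R.degree < (∑ i, n i : ℕ)) : R = 0 := by
  induction n using multiIndex_induction generalizing R with
  | zero => simpa using hR
  | add_single n j ih =>
    have hs := sum_add_single n j 1
    rw [one_smul] at hs
    rw [hs] at hR
    obtain ⟨Q, b, hQ, rfl⟩ := exists_eq_raise_add_C (c j) _ R hR
    have h0 := h j 0 (by simp)
    have hb : b = 0 := by
      rw [pow_zero, one_mul, map_add, moment_raise, zero_add, ← mul_one (C b), ← smul_eq_C_mul,
        map_smul, smul_eq_mul] at h0
      exact (mul_eq_zero.1 h0).resolve_right (moment_one_pos _).ne'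
    subst hb
    rw [C_0, add_zero] at h ⊢
    rw [ih (h.of_raise hc) hQ, map_zero]

theorem IsMultipleHermite.eq {r : ℕ} {c : Fin r → ℝ} (hc : Function.Injective c)
    {n : Fin r → ℕ} {P Q : ℝ[X]} (hP : IsMultipleHermite c n P) (hQ : IsMultipleHermite c n Q) :
    P = Q := by
  refine sub_eq_zero.1 (IsOrthogonal.eq_zero hc (n := n) (fun j k hk => ?_) ?_)
  · rw [mul_sub, map_sub, hP.isOrthogonal j k hk, hQ.isOrthogonal j k hk, sub_zero]
  · rw [← hP.natDegree_eq, ← degree_eq_natDegree hP.monic.ne_zero]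
    refine degree_sub_lt_left ?_ hP.monic.ne_zero ?_
    · rw [degree_eq_natDegree hP.monic.ne_zero, degree_eq_natDegree hQ.monic.ne_zero,
        hP.natDegree_eq, hQ.natDegree_eq]
    · rw [hP.monic.leadingCoeff, hQ.monic.leadingCoeff]

/-! ### Counting sign changes -/

/-- `P` takes nonzero values of alternating signs at `N + 1` increasing points. -/
def Alternates (P : ℝ[X]) (N : ℕ) : Prop :=
  ∃ (s : ℝ) (x : ℕ → ℝ), (∀ i < N, x i < x (i + 1)) ∧
    ∀ i ≤ N, 0 < s * (-1) ^ i * P.eval (x i)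

theorem exists_hasDerivAt_mul_pos {g g' : ℝ → ℝ} (hg : ∀ x, HasDerivAt g (g' x) x) {a b t : ℝ}
    (hab : a < b) (h : t * g a < t * g b) : ∃ y, a < y ∧ y < b ∧ 0 < t * g' y := by
  obtain ⟨y, hy, he⟩ := exists_hasDerivAt_eq_slope g g' hab
    (fun x _ => (hg x).continuousAt.continuousWithinAt) (fun x _ => hg x)
  refine ⟨y, hy.1, hy.2, ?_⟩
  rw [he, ← mul_div_assoc, mul_sub]
  exact div_pos (by linarith) (by linarith)

/-- Rolle's theorem for `P` times a weight decaying at both ends: one more sign change. -/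
theorem Alternates.raise {P : ℝ[X]} {N : ℕ} (h : Alternates P N) (a : ℝ) :
    Alternates (raise a P) (N + 1) := by
  obtain ⟨s, x, hx, hs⟩ := h
  set g : ℝ → ℝ := fun x => P.eval x * Real.exp (-x ^ 2 + a * x) with hgdef
  set g' : ℝ → ℝ := fun x => ((-2 : ℝ) • _root_.raise a P).eval x * Real.exp (-x ^ 2 + a * x)
    with hg'def
  have hg : ∀ x, HasDerivAt g (g' x) x := hasDerivAt_eval_mul_weight a P
  have hsg : ∀ i ≤ N, 0 < s * (-1) ^ i * g (x i) := fun i hi => by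
    have := mul_pos (hs i hi) (Real.exp_pos (-x i ^ 2 + a * x i))
    simpa [hgdef, mul_assoc] using this
  -- The new points interlace the old: `y 0 < x 0 < y 1 < ⋯ < x N < y (N + 1)`. The two outer ones
  -- exist because `g` decays at both ends; indices beyond `N + 1` get a dummy value.
  have key : ∀ i, ∃ y, i ≤ N + 1 → (∀ k, i = k + 1 → x k < y) ∧ (i ≤ N → y < x i) ∧
      0 < s * (-1) ^ i * g' y := by
    intro i
    rcases i with _ | k
    · have ht : Tendsto (fun z => s * g z) atBot (𝓝 0) := by
        simpa using (tendsto_eval_mul_weight_atBot a P).const_mul s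
      have h0 := hsg 0 (Nat.zero_le _)
      rw [pow_zero, mul_one] at h0
      obtain ⟨z, hz, hzx⟩ := ((ht.eventually (gt_mem_nhds h0)).and
        (eventually_lt_atBot (x 0))).exists
      obtain ⟨y, -, hy, hpos⟩ := exists_hasDerivAt_mul_pos hg hzx hz
      exact ⟨y, fun _ => ⟨by simp, fun _ => hy, by simpa using hpos⟩⟩
    · by_cases hk : k + 1 ≤ N
      · have h1 := hsg k (by omega)
        have h2 := hsg (k + 1) hk
        obtain ⟨y, hy1, hy2, hpos⟩ := exists_hasDerivAt_mul_pos hg (t := s * (-1) ^ (k + 1))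
          (hx k (by omega)) (by rw [pow_succ] at h2 ⊢; linarith)
        refine ⟨y, fun _ => ⟨fun m hm => ?_, fun _ => hy2, hpos⟩⟩
        obtain rfl : k = m := by omega
        exact hy1
      · by_cases hkN : k = N
        · subst hkN
          have ht : Tendsto (fun z => s * (-1) ^ k * g z) atTop (𝓝 0) := by
            simpa using (tendsto_eval_mul_weight_atTop a P).const_mul (s * (-1) ^ k)
          obtain ⟨z, hz, hzx⟩ := ((ht.eventually (gt_mem_nhds (hsg k le_rfl))).and
            (eventually_gt_atTop (x k))).exists
          obtain ⟨y, hy, -, hpos⟩ := exists_hasDerivAt_mul_pos hg (t := s * (-1) ^ (k + 1)) hzx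
            (by rw [pow_succ]; linarith)
          refine ⟨y, fun _ => ⟨fun m hm => ?_, fun h => absurd h hk, hpos⟩⟩
          obtain rfl : k = m := by omega
          exact hy
        · exact ⟨0, fun h => by omega⟩
  choose y hy using key
  -- The sign flips because `g'` is `-2` times the raised polynomial times the weight.
  refine ⟨-s, y, fun i hi => ?_, fun i hi => ?_⟩
  · exact ((hy i (by omega)).2.1 (by omega)).trans ((hy (i + 1) (by omega)).1 i rfl)
  · have h1 := (hy i hi).2.2
    have h2 : s * (-1) ^ i * g' (y i) = 2 * Real.exp (-y i ^ 2 + a * y i) *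
        (-s * (-1) ^ i * (_root_.raise a P).eval (y i)) := by
      simp only [hg'def, eval_smul, smul_eq_mul]
      ring
    rw [h2] at h1
    exact (mul_pos_iff_of_pos_left (by positivity)).1 h1

theorem Alternates.ne_zero {P : ℝ[X]} {N : ℕ} (h : Alternates P N) : P ≠ 0 := by
  rintro rfl
  obtain ⟨s, x, -, hs⟩ := h
  simpa using hs 0 (Nat.zero_le _)

theorem alternates_zero {P : ℝ[X]} (hP : P ≠ 0) : Alternates P 0 := by
  obtain ⟨x, hx⟩ : ∃ x, P.eval x ≠ 0 := by
    by_contra! h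
    exact hP (Polynomial.funext (by simpa using h))
  refine ⟨P.eval x, fun _ => x, by simp, fun i hi => ?_⟩
  obtain rfl : i = 0 := by omega
  simpa using mul_self_pos.2 hx

theorem Alternates.le_natDegree {P : ℝ[X]} {N : ℕ} (h : Alternates P N) : N ≤ P.natDegree := by
  have hP := h.ne_zero
  obtain ⟨s, x, hx, hs⟩ := h
  have hroot : ∀ i : Fin N, ∃ z, x i < z ∧ z < x (i + 1) ∧ P.eval z = 0 := by
    intro i
    have h1 := hs i i.2.le
    have h2 := hs (i + 1) i.2
    have hcont : ContinuousOn (fun z => s * (-1) ^ (i : ℕ) * P.eval z)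
        (Set.Icc (x i) (x (i + 1))) := by fun_prop
    obtain ⟨z, hz, hz0⟩ := intermediate_value_Ioo' (hx i i.2).le hcont
      (show (0 : ℝ) ∈ _ from ⟨by rw [pow_succ] at h2; linarith, h1⟩)
    refine ⟨z, hz.1, hz.2, (mul_eq_zero.1 hz0).resolve_left fun h0 => ?_⟩
    rw [h0, zero_mul] at h1
    exact h1.false
  choose z hz1 hz2 hz0 using hroot
  have hmono : ∀ i j, i ≤ j → j ≤ N → x i ≤ x j := by
    intro i j hij
    induction j, hij using Nat.le_induction with
    | base => exact fun _ => le_rfl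
    | succ j _ ih => exact fun hj => (ih (by omega)).trans (hx j (by omega)).le
  have hz : StrictMono z := by
    intro i j hij
    exact (hz2 i).trans_le ((hmono _ _ (Nat.succ_le_of_lt hij) j.2.le).trans (hz1 j).le)
  by_contra! hlt
  exact hP (eq_zero_of_natDegree_lt_card_of_eval_eq_zero P hz.injective hz0 (by simpa using hlt))

/-- Dividing out a zero of even order preserves alternation. -/
theorem Alternates.add_le_natDegree {P : ℝ[X]} {N l : ℕ} (h : Alternates P N) (hl : Even l)
    {x₀ : ℝ} (hdvd : (X - C x₀) ^ l ∣ P) : N + l ≤ P.natDegree := by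
  have hP := h.ne_zero
  obtain ⟨R, rfl⟩ := hdvd
  have hR : R ≠ 0 := right_ne_zero_of_mul hP
  have hR' : Alternates R N := by
    obtain ⟨s, x, hx, hs⟩ := h
    refine ⟨s, x, hx, fun i hi => ?_⟩
    have h1 := hs i hi
    rw [eval_mul, eval_pow, eval_sub, eval_X, eval_C, mul_left_comm] at h1
    exact pos_of_mul_pos_right h1 (hl.pow_nonneg _)
  rw [((monic_X_sub_C x₀).pow l).natDegree_mul' hR, natDegree_pow, natDegree_X_sub_C, mul_one]
  linarith [hR'.le_natDegree]

/-! ### Nonvanishing of the Wronskian -/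

theorem sum_smul_ne_zero {l : ℕ} {f : ℕ → ℝ[X]} (hf : ∀ m, (f m).Monic) {d : ℕ}
    (hd : ∀ m, (f m).natDegree = d + m) {a : Fin l → ℝ} (ha : a ≠ 0) :
    ∑ k, a k • f k ≠ 0 := by
  intro h0
  refine ha ?_
  by_contra hne
  obtain ⟨k₀, hk₀⟩ := Function.ne_iff.1 hne
  have hdeg : ∀ k : Fin l, a k ≠ 0 → (a k • f k).degree = (d + k : ℕ) := fun k hk => by
    rw [degree_smul_of_smul_regular _ (IsSMulRegular.of_ne_zero hk),
      degree_eq_natDegree (hf k).ne_zero, hd]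
  have h := degree_sum_eq_of_disjoint (fun k : Fin l => a k • f k) Finset.univ (by
    rintro i ⟨-, hi⟩ j ⟨-, hj⟩ hij
    simp only [Function.onFun, Function.comp]
    rw [hdeg i fun h => hi (by simp [h]), hdeg j fun h => hj (by simp [h])]
    intro he
    exact hij (Fin.ext (Nat.add_left_cancel (WithBot.coe_injective he))))
  rw [h0, degree_zero] at h
  have := Finset.le_sup (f := fun k : Fin l => (a k • f k).degree) (Finset.mem_univ k₀)
  rw [← h, hdeg k₀ hk₀] at this
  simp at this

/-- Raising is linear and acts on every `H (n + k e_j)` at once with the same coefficients, so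
induction on `n` starts from a mere nonzero polynomial. -/
theorem alternates_sum_smul {r : ℕ} {c : Fin r → ℝ} {H : (Fin r → ℕ) → ℝ[X]}
    (hH : ∀ n, IsMultipleHermite c n (H n))
    (hrec : ∀ n j, H (n + Pi.single j 1) = raise (c j) (H n)) (n : Fin r → ℕ) (j : Fin r)
    {l : ℕ} {a : Fin l → ℝ} (ha : a ≠ 0) :
    Alternates (∑ k : Fin l, a k • H (n + (k : ℕ) • Pi.single j 1)) (∑ i, n i) := by
  induction n using multiIndex_induction with
  | zero =>
    have hne := sum_smul_ne_zero (f := fun m => H (0 + m • Pi.single j 1)) (d := 0)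
      (fun m => (hH _).monic) (fun m => by rw [(hH _).natDegree_eq, sum_add_single]; simp) ha
    simpa using alternates_zero hne
  | add_single n i ih =>
    have hs := sum_add_single n i 1
    rw [one_smul] at hs
    rw [hs]
    convert ih.raise (c i) using 1
    rw [map_sum]
    refine Finset.sum_congr rfl fun k _ => ?_
    rw [map_smul, add_right_comm, hrec]

theorem wronskianDet_ne_zero {r : ℕ} {c : Fin r → ℝ} {H : (Fin r → ℕ) → ℝ[X]}
    (hH : ∀ n, IsMultipleHermite c n (H n))
    (hrec : ∀ n j, H (n + Pi.single j 1) = raise (c j) (H n)) (n : Fin r → ℕ) (j : Fin r)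
    {l : ℕ} (hl1 : 1 ≤ l) (hl : Even l) (x : ℝ) :
    wronskianDet l (fun m => H (n + m • Pi.single j 1)) x ≠ 0 := by
  intro h0
  obtain ⟨a, ha, hMa⟩ := Matrix.exists_mulVec_eq_zero_iff.2 h0
  have halt := alternates_sum_smul hH hrec n j ha
  set P := ∑ k : Fin l, a k • H (n + (k : ℕ) • Pi.single j 1) with hPdef
  have hder : ∀ m ≤ l - 1, (derivative^[m] P).IsRoot x := by
    intro m hm
    have := congrFun hMa ⟨m, by omega⟩
    simp only [Matrix.mulVec, dotProduct, Matrix.of_apply, Pi.zero_apply] at this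
    rw [IsRoot, hPdef, iterate_derivative_sum, eval_finsetSum, ← this]
    refine Finset.sum_congr rfl fun k _ => ?_
    rw [iterate_derivative_smul, eval_smul, smul_eq_mul, mul_comm]
  have hmult := lt_rootMultiplicity_of_isRoot_iterate_derivative halt.ne_zero hder
  have hdvd : (X - C x) ^ l ∣ P := (le_rootMultiplicity_iff halt.ne_zero).1 (by omega)
  have h1 := halt.add_le_natDegree hl hdvd
  have h2 : P.natDegree ≤ ∑ i, n i + (l - 1) := by
    refine natDegree_sum_le_of_forall_le _ _ fun k _ => (natDegree_smul_le _ _).trans ?_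
    rw [(hH _).natDegree_eq, sum_add_single]
    have := k.2
    omega
  omega

/-! ### Sign of the Wronskian at infinity -/

theorem tendsto_eval_div_pow (Q : ℝ[X]) {N : ℕ} (hQ : Q.natDegree ≤ N) :
    Tendsto (fun x : ℝ => Q.eval x / x ^ N) atTop (𝓝 (Q.coeff N)) := by
  have hX : ∀ x : ℝ, x ^ N = (X ^ N : ℝ[X]).eval x := by simp
  simp only [hX]
  by_cases h : Q.coeff N = 0
  · rw [h]
    refine div_tendsto_atTop_zero_of_degree_lt _ _ ?_
    rw [degree_X_pow]
    rw [degree_lt_iff_coeff_zero]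
    intro m hm
    rcases hm.eq_or_lt with rfl | hlt
    · exact h
    · exact coeff_eq_zero_of_natDegree_lt (by omega)
  · have hN : Q.natDegree = N := le_antisymm hQ (le_natDegree_of_ne_zero h)
    have hQ0 : Q ≠ 0 := fun h0 => h (by simp [h0])
    have := div_tendsto_atTop_leadingCoeff_div_of_degree_eq Q (X ^ N)
      (by rw [degree_X_pow, degree_eq_natDegree hQ0, hN])
    simpa [leadingCoeff, hN] using this

theorem tendsto_iterate_derivative_mul_pow_div {P : ℝ[X]} (hP : P.Monic) (i : ℕ) :
    Tendsto (fun x : ℝ => x ^ i * ((x ^ P.natDegree)⁻¹ * (derivative^[i] P).eval x)) atTop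
      (𝓝 (P.natDegree.descFactorial i : ℝ)) := by
  by_cases h : i ≤ P.natDegree
  · have hlim := tendsto_eval_div_pow (derivative^[i] P)
      (natDegree_iterate_derivative P i)
    rw [coeff_iterate_derivative, Nat.sub_add_cancel h, hP.coeff_natDegree, nsmul_one] at hlim
    refine hlim.congr' ?_
    filter_upwards [eventually_gt_atTop 0] with x hx
    have : x ^ P.natDegree = x ^ (P.natDegree - i) * x ^ i := by
      rw [← pow_add, Nat.sub_add_cancel h]
    rw [this]
    field_simp
  · push Not at h
    rw [iterate_derivative_eq_zero h, Nat.descFactorial_eq_zero_iff_lt.2 h]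
    simp

/-- Scaling row `i` by `x ^ i` and column `k` by `x ^ (-(d + k))` leaves a matrix tending to the
descending factorials of `d + k`, whose determinant is the Vandermonde of `d, …, d + l - 1`. -/
theorem eventually_wronskianDet_pos {f : ℕ → ℝ[X]} (hf : ∀ m, (f m).Monic) {d : ℕ}
    (hd : ∀ m, (f m).natDegree = d + m) (l : ℕ) :
    ∀ᶠ x in atTop, 0 < wronskianDet l f x := by
  set v : Fin l → ℝ := fun k => ((d + k : ℕ) : ℝ) with hv
  have hlim : Tendsto (fun x : ℝ => (Matrix.of fun i k : Fin l =>
      x ^ (i : ℕ) * ((x ^ (d + k : ℕ))⁻¹ * (derivative^[(i : ℕ)] (f k)).eval x)).det) atTop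
      (𝓝 (Matrix.of fun i k : Fin l => ((d + k : ℕ).descFactorial i : ℝ)).det) := by
    refine ((continuous_id.matrix_det).tendsto _).comp ?_
    refine tendsto_pi_nhds.2 fun i => tendsto_pi_nhds.2 fun k => ?_
    have := tendsto_iterate_derivative_mul_pow_div (hf k) i
    rwa [hd] at this
  have hpos : 0 < (Matrix.of fun i k : Fin l => ((d + k : ℕ).descFactorial i : ℝ)).det := by
    have h1 := Matrix.det_eval_matrixOfPolynomials_eq_det_vandermonde v
      (fun i => descPochhammer ℝ i) (fun i => descPochhammer_natDegree ℝ i)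
      (fun i => monic_descPochhammer ℝ i)
    have h2 : (Matrix.of fun i k : Fin l => ((d + k : ℕ).descFactorial i : ℝ)) =
        (Matrix.of fun i j : Fin l => (descPochhammer ℝ j).eval (v i)).transpose := by
      ext i k
      simp only [Matrix.transpose_apply, Matrix.of_apply, hv,
        descPochhammer_eval_eq_descFactorial]
    rw [h2, Matrix.det_transpose, ← h1, Matrix.det_vandermonde]
    refine Finset.prod_pos fun i _ => Finset.prod_pos fun k hk => ?_
    have : i < k := Finset.mem_Ioi.1 hk
    simpa [hv] using this
  filter_upwards [hlim.eventually (lt_mem_nhds hpos), eventually_gt_atTop 0] with x hx hx0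
  have hcol := Matrix.det_mul_column (fun i : Fin l => x ^ (i : ℕ)) (Matrix.of fun i k : Fin l =>
    (x ^ (d + k : ℕ))⁻¹ * (derivative^[(i : ℕ)] (f k)).eval x)
  have hrow := Matrix.det_mul_row (fun k : Fin l => (x ^ (d + k : ℕ))⁻¹)
    (Matrix.of fun i k : Fin l => (derivative^[(i : ℕ)] (f k)).eval x)
  simp only [Matrix.of_apply] at hcol hrow
  rw [hcol, hrow, ← mul_assoc] at hx
  refine pos_of_mul_pos_right hx (mul_nonneg ?_ ?_) <;>
    exact Finset.prod_nonneg fun _ _ => by positivity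

theorem continuous_wronskianDet (l : ℕ) (f : ℕ → ℝ[X]) : Continuous (wronskianDet l f) := by
  unfold wronskianDet
  refine Continuous.matrix_det (continuous_matrix fun i k => ?_)
  simp only [Matrix.of_apply]
  fun_prop

theorem wronskianDet_pos {r : ℕ} {c : Fin r → ℝ} {H : (Fin r → ℕ) → ℝ[X]}
    (hH : ∀ n, IsMultipleHermite c n (H n))
    (hrec : ∀ n j, H (n + Pi.single j 1) = raise (c j) (H n)) (n : Fin r → ℕ) (j : Fin r)
    {l : ℕ} (hl1 : 1 ≤ l) (hl : Even l) (x : ℝ) :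
    0 < wronskianDet l (fun m => H (n + m • Pi.single j 1)) x := by
  by_contra! hx
  obtain ⟨y, hy, hxy⟩ := ((eventually_wronskianDet_pos
    (f := fun m => H (n + m • Pi.single j 1)) (d := ∑ i, n i) (fun m => (hH _).monic)
    (fun m => by rw [(hH _).natDegree_eq, sum_add_single]) l).and (eventually_ge_atTop x)).exists
  obtain ⟨z, -, hz⟩ := intermediate_value_Icc hxy
    (continuous_wronskianDet l fun m => H (n + m • Pi.single j 1)).continuousOn
    (show (0 : ℝ) ∈ _ from ⟨hx, hy.le⟩)
  exact wronskianDet_ne_zero hH hrec n j hl1 hl z hz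

/-! ### Wronskian as a multiple of the Hankel determinant -/

/-- The coefficients do not depend on `k`, as a matrix factorization requires; `N` is free so that
all rows can be padded to a common length. -/
theorem exists_iterate_derivative_eq_sum {a : ℝ} {f : ℕ → ℝ[X]}
    (hf : ∀ m, f (m + 1) = raise a (f m)) (i : ℕ) :
    ∃ A : ℕ → ℝ[X], A i = C ((-2) ^ i) ∧ (∀ p, i < p → A p = 0) ∧
      ∀ k N, i < N → derivative^[i] (f k) = ∑ p ∈ Finset.range N, A p * f (p + k) := by
  have hder : ∀ m, derivative (f m) = (C 2 * X - C a) * f m - C 2 * f (m + 1) := by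
    intro m
    have h1 : (C 2 : ℝ[X]) * C (a / 2) = C a := by rw [← C_mul]; congr 1; ring
    have h2 : (C 2 : ℝ[X]) * C (1 / 2) = 1 := by rw [← C_mul, ← C_1]; congr 1; norm_num
    rw [hf, raise_apply]
    linear_combination (-f m) * h1 - derivative (f m) * h2
  induction i with
  | zero =>
    refine ⟨fun p => if p = 0 then 1 else 0, by simp, fun p hp => by simp [hp.ne'], ?_⟩
    intro k N hN
    simp [hN]
  | succ i ih =>
    obtain ⟨A, hA, hA0, hsum⟩ := ih
    -- Product rule with `f_m' = (2x - a) f_m - 2 f_{m+1}`; the shifted term has no contribution at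
    -- `p = 0`.
    refine ⟨fun p => derivative (A p) + (C 2 * X - C a) * A p -
      C 2 * (if p = 0 then 0 else A (p - 1)), ?_, ?_, ?_⟩
    · simp only [hA0 (i + 1) (by omega), Nat.succ_ne_zero, if_false, Nat.add_sub_cancel, hA]
      rw [derivative_zero, mul_zero, ← C_mul, zero_add, zero_sub, ← C_neg]
      congr 1
      ring
    · intro p hp
      simp [hA0 p (by omega), hA0 (p - 1) (by omega)]
    · intro k N hN
      obtain ⟨M, rfl⟩ : ∃ M, N = M + 1 := ⟨N - 1, by omega⟩
      have hshift : ∑ p ∈ Finset.range (M + 1), (if p = 0 then 0 else A (p - 1)) * f (p + k) =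
          ∑ p ∈ Finset.range (M + 1), A p * f (p + k + 1) := by
        rw [Finset.sum_range_succ', Finset.sum_range_succ _ M, hA0 M (by omega)]
        simp [add_right_comm]
      rw [Function.iterate_succ_apply', hsum k (M + 1) (by omega), derivative_sum]
      simp only [derivative_mul, hder, sub_mul, add_mul, mul_assoc, Finset.sum_sub_distrib,
        Finset.sum_add_distrib]
      simp only [← Finset.mul_sum, hshift, mul_sub, Finset.sum_sub_distrib]
      simp only [Finset.mul_sum, mul_left_comm]
      ring

theorem wronskianDet_eq_hankelDet {a : ℝ} {f : ℕ → ℝ[X]}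
    (hf : ∀ m, f (m + 1) = raise a (f m)) (l : ℕ) (x : ℝ) :
    wronskianDet l f x = (-2 : ℝ) ^ (l * (l - 1) / 2) * hankelDet l f x := by
  choose A hA hA0 hsum using exists_iterate_derivative_eq_sum hf
  set M : Matrix (Fin l) (Fin l) ℝ := Matrix.of fun i p => (A i p).eval x with hM
  have hmul : (Matrix.of fun i k : Fin l => (derivative^[(i : ℕ)] (f k)).eval x) =
      M * Matrix.of fun i k : Fin l => (f ((i : ℕ) + (k : ℕ))).eval x := by
    ext i k
    rw [Matrix.mul_apply]
    simp only [hM, Matrix.of_apply]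
    rw [hsum i k l i.2, eval_finsetSum, Finset.sum_range]
    simp
  have hdet : M.det = (-2 : ℝ) ^ (l * (l - 1) / 2) := by
    rw [Matrix.det_of_isLowerTriangular M fun i p hip => ?_]
    · simp only [hM, Matrix.of_apply, hA, eval_C]
      rw [Finset.prod_pow_eq_pow_sum, Fin.sum_univ_eq_sum_range (fun i => i) l,
        Finset.sum_range_id]
    · have : (i : ℕ) < p := hip
      simp [hM, hA0 i p this]
  rw [wronskianDet, hmul, Matrix.det_mul, hdet, hankelDet]

theorem corollary4p3 {r : ℕ} (c : Fin r → ℝ) (hc : Function.Injective c) :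
    (∀ n : Fin r → ℕ, ∃! P : Polynomial ℝ, IsMultipleHermite c n P) ∧
    ∀ H : (Fin r → ℕ) → Polynomial ℝ, (∀ n : Fin r → ℕ, IsMultipleHermite c n (H n)) →
      ∀ (n : Fin r → ℕ) (j : Fin r) (l : ℕ), 1 ≤ l →
        (∀ x : ℝ,
          wronskianDet l (fun m => H (n + m • Pi.single j 1)) x =
            (-2 : ℝ) ^ (l * (l - 1) / 2) * hankelDet l (fun m => H (n + m • Pi.single j 1)) x) ∧
        (Even l → ∀ x : ℝ,
          0 < (-1 : ℝ) ^ (l * (l - 1) / 2) *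
            hankelDet l (fun m => H (n + m • Pi.single j 1)) x) := by
  refine ⟨fun n => ?_, fun H hH n j l hl1 => ?_⟩
  · obtain ⟨P, hP⟩ := exists_isMultipleHermite c n
    exact ⟨P, hP, fun Q hQ => hQ.eq hc hP⟩
  have hrec : ∀ n j, H (n + Pi.single j 1) = raise (c j) (H n) := fun n j =>
    (hH _).eq hc ((hH n).raise j)
  have hW := wronskianDet_eq_hankelDet (a := c j) (f := fun m => H (n + m • Pi.single j 1))
    (fun m => by rw [succ_nsmul, ← add_assoc, hrec]) l
  refine ⟨hW, fun hl x => ?_⟩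
  have hpos := wronskianDet_pos hH hrec n j hl1 hl x
  rw [hW, show (-2 : ℝ) = 2 * -1 by norm_num, mul_pow, mul_assoc] at hpos
  exact (mul_pos_iff_of_pos_left (by positivity)).1 hpos
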